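/- For positive integers $k$ and $n$, call a set of integers $k$-AP-free if it contains no $k$-term arithmetic progression $a, a+d, \dots, a+(k-1)d$ with $d\ge 1$. Let $r_k(n)$ be the maximum size of a $k$-AP-free subset of $[n]=\{1,2,\dots,n\}$, and let $R_k(n)$ be the number of $k$-AP-free subsets of $[n]$. **Theorem.** For every integer $k\ge 3$ there is a constant $C=C(k)>0$ such that $$R_k(n)\le 2^{C\, r_k(n)}\quad\text{for infinitely many positive integers } n.$$ This is optimal up to the constant in the exponent: $R_k(n)\ge 2^{r_k(n)}$ for every positive integer $n$. -/

import Mathlib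

/-- `S` is `k`-AP-free: it contains no `k`-term arithmetic progression
`a, a + d, …, a + (k - 1) d` with positive common difference `d`. -/
def APFree (k : ℕ) (S : Finset ℕ) : Prop :=
  ¬ ∃ a d : ℕ, 0 < d ∧ ∀ i < k, a + i * d ∈ S

open Classical in
/-- The family of all `k`-AP-free subsets of `[n] = {1, …, n}`. -/
noncomputable def apFreeSubsets (k n : ℕ) : Finset (Finset ℕ) :=
  (Finset.Icc 1 n).powerset.filter (APFree k)

/-- `r_k(n)`: the maximum size of a `k`-AP-free subset of `[n]`. -/
noncomputable def apFreeMax (k n : ℕ) : ℕ :=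
  (apFreeSubsets k n).sup Finset.card

/-- `R_k(n)`: the number of `k`-AP-free subsets of `[n]`. -/
noncomputable def apFreeCount (k n : ℕ) : ℕ :=
  (apFreeSubsets k n).card

/-! The proof combines hypergraph containers with a supersaturation estimate. If every
$A\subseteq[n]$ of size at least a constant times $r_k(n)$ contains many $k$-APs, then the
$k$-AP-free sets lie in few containers of size $O(r_k(n))$, and counting the subsets of the
containers bounds $R_k(n)$.

Containers (`exists_containers`): the $k$-APs in $A$ contain a linear family of bounded degree that
is still dense (`exists_linear_family_ap`). For linear families the container algorithm is simple:
links of a vertex have degree at most one, so passing from a family to a union of links lowers the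
uniformity by one and keeps linearity and degree bounds. Each use shrinks a set by a constant
factor, and iteration (`coverable_of_forall_large`) brings the size down to the threshold.

Supersaturation (`primeCounting_mul_card_le`): $A$ is averaged over $M$-term progressions with prime
difference $d\le X$. A piece with more than $r_k(M)$ points contains $k$-APs. A $k$-AP of difference
$y$ is counted only for primes dividing $y$, hence at most $M\log_2 n$ times.

This needs $r_k(M)/M$ comparable to $r_k(n)/n$ for an $M$ far below $n$. With $n=2^{t^2}$ and
$M=2^{(t-3k)^2}$ this holds for infinitely many $t$, since otherwise the density would fall below
Behrend's bound (`exists_density_le_mul_density`). Behrend's bound also makes the number of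
containers negligible against $2^{r_k(n)}$. -/

/-! ### Covers by containers. -/

/-- The sets of the family `F` are covered by at most `M` sets, all of which satisfy `p`. -/
def Coverable {V : Type*} (p : Finset V → Prop) (F : Set (Finset V)) (M : ℕ) : Prop :=
  ∃ K : Finset (Finset V), K.card ≤ M ∧ (∀ C ∈ K, p C) ∧ ∀ I ∈ F, ∃ C ∈ K, I ⊆ C

namespace Coverable

variable {V : Type*} {p q : Finset V → Prop} {F F₁ F₂ : Set (Finset V)} {M M₁ M₂ : ℕ}

theorem mono (h : Coverable p F₁ M₁) (hF : F₂ ⊆ F₁) (hM : M₁ ≤ M₂) : Coverable p F₂ M₂ := by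
  obtain ⟨K, h1, h2, h3⟩ := h
  exact ⟨K, h1.trans hM, h2, fun I hI => h3 I (hF hI)⟩

theorem mono_prop (h : Coverable p F M) (hpq : ∀ C, p C → q C) : Coverable q F M := by
  obtain ⟨K, h1, h2, h3⟩ := h
  exact ⟨K, h1, fun C hC => hpq C (h2 C hC), h3⟩

theorem of_forall_subset {C : Finset V} (hC : p C) (h : ∀ I ∈ F, I ⊆ C) : Coverable p F 1 :=
  ⟨{C}, by simp, by simpa using hC, fun I hI => ⟨C, by simp, h I hI⟩⟩

theorem union (h₁ : Coverable p F₁ M₁) (h₂ : Coverable p F₂ M₂) :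
    Coverable p (F₁ ∪ F₂) (M₁ + M₂) := by
  classical
  obtain ⟨K, h1, h2, h3⟩ := h₁
  obtain ⟨K', h1', h2', h3'⟩ := h₂
  refine ⟨K ∪ K', (Finset.card_union_le _ _).trans (add_le_add h1 h1'), ?_, ?_⟩
  · intro C hC
    rcases Finset.mem_union.1 hC with hC | hC
    exacts [h2 C hC, h2' C hC]
  · rintro I (hI | hI)
    · obtain ⟨C, hC, hIC⟩ := h3 I hI
      exact ⟨C, Finset.mem_union_left _ hC, hIC⟩
    · obtain ⟨C, hC, hIC⟩ := h3' I hI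
      exact ⟨C, Finset.mem_union_right _ hC, hIC⟩

/-- Refining every container of a cover. -/
theorem bind (h : Coverable p F M₁)
    (h' : ∀ C, p C → Coverable q {I | I ∈ F ∧ I ⊆ C} M₂) : Coverable q F (M₁ * M₂) := by
  classical
  obtain ⟨K, h1, h2, h3⟩ := h
  choose! K' hK' using h'
  refine ⟨K.biUnion K', ?_, ?_, ?_⟩
  · refine (Finset.card_biUnion_le_card_mul _ _ _ fun C hC => (hK' C (h2 C hC)).1).trans ?_
    gcongr
  · intro D hD
    obtain ⟨C, hC, hD⟩ := Finset.mem_biUnion.1 hD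
    exact (hK' C (h2 C hC)).2.1 D hD
  · intro I hI
    obtain ⟨C, hC, hIC⟩ := h3 I hI
    obtain ⟨D, hD, hID⟩ := (hK' C (h2 C hC)).2.2 I ⟨hI, hIC⟩
    exact ⟨D, Finset.mem_biUnion.2 ⟨C, hC, hD⟩, hID⟩

end Coverable

/-! ### The container theorem for linear uniform families. -/

namespace SetFamily

variable {V : Type*} [DecidableEq V]

/-- The number of members of the family `H` that contain `v`. -/
def deg (H : Finset (Finset V)) (v : V) : ℕ := (H.filter (v ∈ ·)).card

/-- Any two distinct members share at most one point. -/
def Linear (H : Finset (Finset V)) : Prop :=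
  ∀ e ∈ H, ∀ f ∈ H, 2 ≤ (e ∩ f).card → e = f

/-- `I` contains no member of `H`. -/
def Indep (H : Finset (Finset V)) (I : Finset V) : Prop := ∀ e ∈ H, ¬ e ⊆ I

/-- The sets obtained from the members of `H` through `v` by deleting `v`. -/
def link (H : Finset (Finset V)) (v : V) : Finset (Finset V) :=
  (H.filter (v ∈ ·)).image (·.erase v)

theorem mem_link {H : Finset (Finset V)} {v : V} {g : Finset V} :
    g ∈ link H v ↔ ∃ e ∈ H, v ∈ e ∧ e.erase v = g := by
  simp [link, and_assoc]

theorem card_link (H : Finset (Finset V)) (v : V) : (link H v).card = deg H v := by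
  refine Finset.card_image_of_injOn ?_
  intro e he f hf hef
  simp only [Finset.coe_filter, Set.mem_ofPred_eq] at he hf
  have := congrArg (insert v) hef
  simpa [Finset.insert_erase he.2, Finset.insert_erase hf.2] using this

theorem sum_deg_eq {H : Finset (Finset V)} {A : Finset V} {r : ℕ}
    (h : ∀ e ∈ H, e ⊆ A ∧ e.card = r) : ∑ v ∈ A, deg H v = r * H.card := by
  unfold deg
  simp_rw [Finset.card_filter]
  rw [Finset.sum_comm, Finset.sum_congr rfl (g := fun _ => r), Finset.sum_const, smul_eq_mul,
    mul_comm]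
  intro e he
  rw [← Finset.card_filter, Finset.filter_mem_eq_inter, Finset.inter_eq_right.2 (h e he).1,
    (h e he).2]

theorem deg_union_le (G H : Finset (Finset V)) (v : V) : deg (G ∪ H) v ≤ deg G v + deg H v := by
  unfold deg
  rw [Finset.filter_union]
  exact Finset.card_union_le _ _

/-- At most `|P| Δ` members of a family of maximum degree `Δ` meet `P`. -/
theorem card_filter_not_disjoint_le {H : Finset (Finset V)} {P : Finset V} {Δ : ℕ}
    (h : ∀ v, deg H v ≤ Δ) : (H.filter (fun e => ¬ Disjoint e P)).card ≤ P.card * Δ := by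
  have hsub : H.filter (fun e => ¬ Disjoint e P) ⊆ P.biUnion fun v => H.filter (v ∈ ·) := by
    intro e he
    rw [Finset.mem_filter, Finset.not_disjoint_iff] at he
    obtain ⟨he, v, hve, hvP⟩ := he
    exact Finset.mem_biUnion.2 ⟨v, hvP, Finset.mem_filter.2 ⟨he, hve⟩⟩
  exact (Finset.card_le_card hsub).trans
    (Finset.card_biUnion_le_card_mul _ _ _ fun v _ => h v)

/-- In the link of a vertex of a linear family every vertex has degree at most one. -/
theorem deg_link_le_one {H : Finset (Finset V)} (hH : Linear H) (v u : V) :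
    deg (link H v) u ≤ 1 := by
  refine Finset.card_le_one.2 ?_
  intro g hg g' hg'
  rw [Finset.mem_filter, mem_link] at hg hg'
  obtain ⟨⟨e, he, hve, rfl⟩, hu⟩ := hg
  obtain ⟨⟨f, hf, hvf, rfl⟩, hu'⟩ := hg'
  rw [Finset.mem_erase] at hu hu'
  have : e = f := by
    refine hH e he f hf ?_
    have h2 : ({u, v} : Finset V) ⊆ e ∩ f := by
      intro x hx
      rcases Finset.mem_insert.1 hx with rfl | hx
      · exact Finset.mem_inter.2 ⟨hu.2, hu'.2⟩
      · rw [Finset.mem_singleton.1 hx]; exact Finset.mem_inter.2 ⟨hve, hvf⟩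
    calc 2 = ({u, v} : Finset V).card := (Finset.card_pair hu.1).symm
      _ ≤ _ := Finset.card_le_card h2
  rw [this]

/-- The members of `H` that avoid `P` and all vertices of degree at least `D` in `G`. -/
def unspoiled (H G : Finset (Finset V)) (A P : Finset V) (D : ℕ) : Finset (Finset V) :=
  H.filter fun e => Disjoint e (P ∪ A.filter fun u => D ≤ deg G u)

theorem mem_unspoiled {H G : Finset (Finset V)} {A P e : Finset V} {D : ℕ} :
    e ∈ unspoiled H G A P D ↔
      e ∈ H ∧ Disjoint e P ∧ Disjoint e (A.filter fun u => D ≤ deg G u) := by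
  simp [unspoiled, Finset.disjoint_union_right]

/-- The states `(P, G)` of the container algorithm for `H`: the vertices of `P` have been
processed, and `G` is a family of bounded degree obtained from links of vertices of `P`. -/
structure IsPartialLink (H : Finset (Finset V)) (A : Finset V) (s D : ℕ) (P : Finset V)
    (G : Finset (Finset V)) : Prop where
  processed_subset : P ⊆ A
  uniform : ∀ g ∈ G, g ⊆ A ∧ g.card = s + 1
  linear : Linear G
  deg_le : ∀ v, deg G v ≤ D
  exists_parent : ∀ g ∈ G, ∃ e ∈ H, g ⊆ e ∧ ¬ Disjoint e P

section step

variable {H G : Finset (Finset V)} {A P : Finset V} {s D : ℕ}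

theorem IsPartialLink.insert_processed (h : IsPartialLink H A s D P G) {v : V} (hv : v ∈ A) :
    IsPartialLink H A s D (insert v P) G where
  processed_subset := Finset.insert_subset hv h.processed_subset
  uniform := h.uniform
  linear := h.linear
  deg_le := h.deg_le
  exists_parent g hg := by
    obtain ⟨e, he, hge, heP⟩ := h.exists_parent g hg
    exact ⟨e, he, hge, fun hd => heP (hd.mono_right (Finset.subset_insert _ _))⟩

/-- The parent of `g` meets `P` while `e` avoids `P`, so they are distinct members of the linear
family `H`. -/
theorem IsPartialLink.inter_card_lt (hH : Linear H) (h : IsPartialLink H A s D P G)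
    {g e : Finset V} (hg : g ∈ G) (he : e ∈ unspoiled H G A P D) : (g ∩ e).card < 2 := by
  by_contra! hlt
  obtain ⟨f, hf, hgf, hfP⟩ := h.exists_parent g hg
  rw [mem_unspoiled] at he
  have : f = e := hH f hf e he.1
    (hlt.trans (Finset.card_le_card (Finset.inter_subset_inter_right hgf)))
  exact hfP (this ▸ he.2.1)

/-- Ensures that a new link adds its full size to `G`. For `s ≥ 1` a common member would have two
points in common with an unspoiled edge. For `s = 0` members are singletons, and `D ≤ 1` makes every
vertex already covered by `G` saturated. -/
theorem IsPartialLink.disjoint_link (hH : Linear H)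
    (hHA : ∀ e ∈ H, e ⊆ A ∧ e.card = s + 2) (hD : s = 0 → D ≤ 1)
    (h : IsPartialLink H A s D P G) (v : V) :
    Disjoint G (link (unspoiled H G A P D) v) := by
  rw [Finset.disjoint_left]
  intro g hg hg'
  obtain ⟨e, he, hve, rfl⟩ := mem_link.1 hg'
  have hcard := (h.uniform _ hg).2
  have h1 := h.inter_card_lt hH hg he
  rw [Finset.inter_eq_left.2 (Finset.erase_subset _ _), hcard] at h1
  obtain ⟨u, hu⟩ : (e.erase v).Nonempty := Finset.card_pos.1 (by omega)
  rw [mem_unspoiled] at he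
  have hue := Finset.mem_of_mem_erase hu
  refine Finset.disjoint_left.1 he.2.2 hue (Finset.mem_filter.2 ⟨(hHA e he.1).1 hue, ?_⟩)
  refine (hD (by omega)).trans (Finset.card_pos.2 ⟨_, Finset.mem_filter.2 ⟨hg, hu⟩⟩)

/-- The step for a processed vertex that lies in the independent set: its link may then be added to
the forbidden sets `G`. -/
theorem IsPartialLink.union_link (hH : Linear H)
    (hHA : ∀ e ∈ H, e ⊆ A ∧ e.card = s + 2)
    (h : IsPartialLink H A s D P G) {v : V} (hv : v ∈ A) :
    IsPartialLink H A s D (insert v P) (G ∪ link (unspoiled H G A P D) v) where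
  processed_subset := Finset.insert_subset hv h.processed_subset
  uniform g hg := by
    rcases Finset.mem_union.1 hg with hg | hg
    · exact h.uniform g hg
    · obtain ⟨e, he, hve, rfl⟩ := mem_link.1 hg
      obtain ⟨h1, h2⟩ := hHA e (mem_unspoiled.1 he).1
      exact ⟨(Finset.erase_subset _ _).trans h1, by rw [Finset.card_erase_of_mem hve]; omega⟩
  linear := by
    have key : ∀ g ∈ G, ∀ f ∈ link (unspoiled H G A P D) v, ¬ 2 ≤ (g ∩ f).card := by
      intro g hg f hf h2
      obtain ⟨e, he, hve, rfl⟩ := mem_link.1 hf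
      exact absurd (h.inter_card_lt hH hg he) (not_lt.2 (h2.trans (Finset.card_le_card
        (Finset.inter_subset_inter_left (Finset.erase_subset _ _)))))
    intro g hg f hf h2
    rcases Finset.mem_union.1 hg with hg | hg <;> rcases Finset.mem_union.1 hf with hf | hf
    · exact h.linear g hg f hf h2
    · exact absurd h2 (key g hg f hf)
    · exact absurd (by rwa [Finset.inter_comm]) (key f hf g hg)
    · obtain ⟨e, he, hve, rfl⟩ := mem_link.1 hg
      obtain ⟨e', he', hve', rfl⟩ := mem_link.1 hf
      rw [hH e (mem_unspoiled.1 he).1 e' (mem_unspoiled.1 he').1 (h2.trans (Finset.card_le_card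
        (Finset.inter_subset_inter (Finset.erase_subset _ _) (Finset.erase_subset _ _))))]
  deg_le u := by
    have hlin : Linear (unspoiled H G A P D) := fun e he f hf =>
      hH e (mem_unspoiled.1 he).1 f (mem_unspoiled.1 hf).1
    have h1 := deg_link_le_one hlin v u
    have h2 := deg_union_le G (link (unspoiled H G A P D) v) u
    -- A saturated vertex gains nothing, since unspoiled edges avoid it; any other vertex gains at
    -- most one by linearity.
    by_cases hu : D ≤ deg G u
    · have h0 : deg (link (unspoiled H G A P D) v) u = 0 := by
        refine Finset.card_eq_zero.2 (Finset.filter_eq_empty_iff.2 ?_)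
        intro g hg hug
        obtain ⟨e, he, hve, rfl⟩ := mem_link.1 hg
        rw [mem_unspoiled] at he
        have hue := Finset.mem_of_mem_erase hug
        exact Finset.disjoint_left.1 he.2.2 hue
          (Finset.mem_filter.2 ⟨(hHA e he.1).1 hue, hu⟩)
      have := h.deg_le u
      omega
    · omega
  exists_parent g hg := by
    rcases Finset.mem_union.1 hg with hg | hg
    · exact (h.insert_processed hv).exists_parent g hg
    · obtain ⟨e, he, hve, rfl⟩ := mem_link.1 hg
      exact ⟨e, (mem_unspoiled.1 he).1, Finset.erase_subset _ _,
        Finset.not_disjoint_iff.2 ⟨v, hve, Finset.mem_insert_self _ _⟩⟩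

/-- As long as few vertices are processed and `G` is small, some vertex has large degree among
the unspoiled members of `H`. -/
theorem IsPartialLink.exists_large_deg {b L : ℕ} (hHA : ∀ e ∈ H, e ⊆ A ∧ e.card = s + 2)
    (hdeg : ∀ v, deg H v ≤ L ^ (s + 1)) (hcard : A.card * L ^ (s + 1) ≤ b * H.card)
    (hL : 0 < L) (h : IsPartialLink H A s (L ^ s) P G)
    (hG : 8 * b * (s + 1) * G.card < A.card * L ^ s) (hP : 8 * b * P.card < A.card) :
    ∃ v ∈ A, v ∉ P ∧ L ^ (s + 1) ≤ 2 * b * deg (unspoiled H G A P (L ^ s)) v := by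
  set T := A.filter fun u => L ^ s ≤ deg G u with hT
  have hLs : 0 < L ^ s := pow_pos hL _
  have hT1 : T.card * L ^ s ≤ (s + 1) * G.card := by
    rw [← sum_deg_eq h.uniform, ← smul_eq_mul]
    calc T.card • L ^ s ≤ ∑ u ∈ T, deg G u :=
          Finset.card_nsmul_le_sum _ _ _ fun u hu => (Finset.mem_filter.1 hu).2
      _ ≤ _ := Finset.sum_le_sum_of_subset (Finset.filter_subset _ _)
  have hT2 : 8 * b * T.card ≤ A.card := by
    refine Nat.le_of_mul_le_mul_right ?_ hLs
    calc 8 * b * T.card * L ^ s = 8 * b * (T.card * L ^ s) := by ring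
      _ ≤ 8 * b * ((s + 1) * G.card) := by gcongr
      _ ≤ A.card * L ^ s := by linarith
  set U := unspoiled H G A P (L ^ s) with hU
  have hsplit : U.card + (H.filter fun e => ¬ Disjoint e (P ∪ T)).card = H.card :=
    Finset.card_filter_add_card_filter_not _
  have hbad := card_filter_not_disjoint_le (P := P ∪ T) hdeg
  have hPT := Finset.card_union_le P T
  have hU2 : A.card * L ^ (s + 1) ≤ 2 * b * U.card := by
    -- `P` and the saturated set `T` each have at most `|A| / (8b)` points, so deleting the edges
    -- that meet them costs at most a quarter of the guaranteed edges.
    have h1 : 4 * b * (P ∪ T).card ≤ A.card := by nlinarith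
    have h2 : 4 * b * (H.filter fun e => ¬ Disjoint e (P ∪ T)).card ≤ A.card * L ^ (s + 1) :=
      calc _ ≤ 4 * b * ((P ∪ T).card * L ^ (s + 1)) := by gcongr
        _ = 4 * b * (P ∪ T).card * L ^ (s + 1) := by ring
        _ ≤ _ := by gcongr
    nlinarith
  have hUA : ∀ e ∈ U, e ⊆ A ∧ e.card = s + 2 := fun e he => hHA e (mem_unspoiled.1 he).1
  have hA : A.Nonempty := Finset.card_pos.1 (by omega)
  by_contra! hcon
  have hlt : ∀ v ∈ A, 2 * b * deg U v < L ^ (s + 1) := by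
    intro v hv
    by_cases hvP : v ∈ P
    · have : deg U v = 0 := by
        refine Finset.card_eq_zero.2 (Finset.filter_eq_empty_iff.2 ?_)
        intro e he hve
        exact Finset.disjoint_left.1 (mem_unspoiled.1 he).2.1 hve hvP
      rw [this]; positivity
    · exact hcon v hv hvP
  have hsum : ∑ v ∈ A, 2 * b * deg U v < ∑ v ∈ A, L ^ (s + 1) := Finset.sum_lt_sum_of_nonempty hA hlt
  rw [← Finset.mul_sum, sum_deg_eq hUA, Finset.sum_const, smul_eq_mul] at hsum
  have : 2 * b * U.card ≤ 2 * b * ((s + 2) * U.card) := by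
    gcongr
    exact Nat.le_mul_of_pos_left _ (by omega)
  omega

end step

/-- The containers of a linear uniform family `H` on `A` obtained from the containers `hW` of the
families `G` produced by the algorithm. The algorithm has reached the state `(P, G)`, and `S` is
the set of the processed vertices that belong to the independent set. -/
theorem coverable_of_isPartialLink {H : Finset (Finset V)} {A : Finset V} {s b L W : ℕ}
    {p : Finset V → Prop} (hHA : ∀ e ∈ H, e ⊆ A ∧ e.card = s + 2) (hH : Linear H)
    (hdeg : ∀ v, deg H v ≤ L ^ (s + 1)) (hcard : A.card * L ^ (s + 1) ≤ b * H.card)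
    (hL : 0 < L) (hb : 0 < b) (hWpos : 0 < W)
    (hsmall : ∀ P S, P ⊆ A → A.card ≤ 8 * b * P.card → S.card ≤ A.card / L + 1 →
      p (A \ (P \ S)))
    (hW : ∀ G : Finset (Finset V), (∀ g ∈ G, g ⊆ A ∧ g.card = s + 1) → Linear G →
      (∀ v, deg G v ≤ L ^ s) → A.card * L ^ s ≤ 8 * b * (s + 1) * G.card →
      Coverable p {I | I ⊆ A ∧ Indep G I} W) (m : ℕ) :
    ∀ (P S : Finset V) (G : Finset (Finset V)) (j : ℕ), IsPartialLink H A s (L ^ s) P G →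
      (A \ P).card ≤ m → S.card ≤ j → j ≤ A.card / L + 1 →
      j * L ^ (s + 1) ≤ 2 * b * G.card →
      Coverable p {I | I ⊆ A ∧ Indep H I ∧ Indep G I ∧ Disjoint (P \ S) I}
        ((m + 1) ^ (A.card / L + 1 - j) * W) := by
  induction m with
  | zero =>
    intro P S G j h hm hS hj hjG
    have hPA : P = A := by
      refine h.processed_subset.antisymm ?_
      rw [← Finset.sdiff_eq_empty_iff_subset]
      exact Finset.card_eq_zero.1 (by omega)
    refine (Coverable.of_forall_subset (hsmall P S h.processed_subset ?_ (hS.trans hj))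
      ?_).mono subset_rfl (Nat.one_le_iff_ne_zero.2 (by positivity))
    · rw [hPA]; nlinarith
    · rintro I ⟨h1, -, -, h4⟩ x hx
      exact Finset.mem_sdiff.2 ⟨h1 hx, fun hx' => Finset.disjoint_left.1 h4 hx' hx⟩
  | succ m ih =>
    intro P S G j h hm hS hj hjG
    by_cases hG : A.card * L ^ s ≤ 8 * b * (s + 1) * G.card
    · refine (hW G h.uniform h.linear h.deg_le hG).mono ?_
        (Nat.le_mul_of_pos_left _ (by positivity))
      rintro I ⟨h1, -, h3, -⟩
      exact ⟨h1, h3⟩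
    by_cases hP : A.card ≤ 8 * b * P.card
    · refine (Coverable.of_forall_subset (hsmall P S h.processed_subset hP (hS.trans hj))
        ?_).mono subset_rfl (Nat.one_le_iff_ne_zero.2 (by positivity))
      rintro I ⟨h1, -, -, h4⟩ x hx
      exact Finset.mem_sdiff.2 ⟨h1 hx, fun hx' => Finset.disjoint_left.1 h4 hx' hx⟩
    push Not at hG hP
    obtain ⟨v, hvA, hvP, hv⟩ := h.exists_large_deg hHA hdeg hcard hL hG hP
    -- Each selected vertex added at least `L ^ (s + 1) / (2b)` sets to `G`, so while `G` is small
    -- few vertices have been selected.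
    have hjlt : j < A.card / L + 1 := by
      rw [Nat.lt_succ_iff, Nat.le_div_iff_mul_le hL]
      refine Nat.le_of_mul_le_mul_right ?_ (pow_pos hL s)
      have : 2 * b * G.card ≤ 8 * b * (s + 1) * G.card := by
        exact Nat.mul_le_mul_right _ (by nlinarith)
      calc j * L * L ^ s = j * L ^ (s + 1) := by ring
        _ ≤ _ := by omega
    have hm' : (A \ insert v P).card ≤ m := by
      have : (A \ insert v P).card < (A \ P).card := by
        refine Finset.card_lt_card ⟨Finset.sdiff_subset_sdiff subset_rfl
          (Finset.subset_insert _ _), fun hsub => ?_⟩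
        have := hsub (Finset.mem_sdiff.2 ⟨hvA, hvP⟩)
        simp at this
      omega
    have hs0 : s = 0 → L ^ s ≤ 1 := by rintro rfl; simp
    -- Branch on whether `v` lies in the independent set: if so, its link joins `G`; if not, `v`
    -- leaves the container.
    have hyes := ih (insert v P) (insert v S) _ (j + 1) (h.union_link hH hHA hvA) hm'
      ((Finset.card_insert_le _ _).trans (by omega)) hjlt (by
        rw [Finset.card_union_of_disjoint (h.disjoint_link hH hHA hs0 v), card_link]
        nlinarith)
    have hno := ih (insert v P) S G j (h.insert_processed hvA) hm' hS hj hjG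
    refine (hyes.union hno).mono ?_ ?_
    · rintro I ⟨h1, h2, h3, h4⟩
      by_cases hvI : v ∈ I
      · left
        refine ⟨h1, h2, ?_, ?_⟩
        · intro g hg hgI
          rcases Finset.mem_union.1 hg with hg | hg
          · exact h3 g hg hgI
          · obtain ⟨e, he, hve, rfl⟩ := mem_link.1 hg
            refine h2 e (mem_unspoiled.1 he).1 ?_
            rw [← Finset.insert_erase hve]
            exact Finset.insert_subset hvI hgI
        · refine h4.mono_left ?_
          intro x hx
          simp only [Finset.mem_sdiff, Finset.mem_insert, not_or] at hx ⊢
          tauto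
      · right
        refine ⟨h1, h2, h3, ?_⟩
        rw [Finset.disjoint_left] at h4 ⊢
        intro x hx hxI
        rw [Finset.mem_sdiff, Finset.mem_insert] at hx
        rcases hx with ⟨rfl | hx, hxS⟩
        · exact hvI hxI
        · exact h4 (Finset.mem_sdiff.2 ⟨hx, hxS⟩) hxI
    -- Pascal-type recurrence: a branch is determined by the times of its at most `A.card / L + 1 -
    -- j` remaining selections.
    · obtain ⟨e, he⟩ : ∃ e, A.card / L + 1 - j = e + 1 := ⟨A.card / L - j, by omega⟩
      rw [he, show A.card / L + 1 - (j + 1) = e by omega, ← add_mul]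
      gcongr
      calc (m + 1) ^ e + (m + 1) ^ (e + 1) = (m + 1) ^ e * (m + 1 + 1) := by ring
        _ ≤ (m + 1 + 1) ^ e * (m + 1 + 1) := by gcongr; omega
        _ = _ := by ring

/-- **Containers for linear families.** If a linear `(s + 1)`-uniform family on `A` has maximum
degree at most `L ^ s` and average degree of the same order, then its independent sets are covered
by few sets that are smaller than `A` by a constant factor. -/
theorem exists_containers (s : ℕ) : ∀ b : ℕ, 0 < b → ∃ B, b ≤ B ∧
    ∀ (L : ℕ) (A : Finset V) (H : Finset (Finset V)), 16 * B ≤ L → L ≤ A.card →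
      (∀ e ∈ H, e ⊆ A ∧ e.card = s + 1) → Linear H → (∀ v, deg H v ≤ L ^ s) →
      A.card * L ^ s ≤ b * H.card →
      Coverable (fun C => C ⊆ A ∧ B * C.card + A.card ≤ B * A.card) {I | I ⊆ A ∧ Indep H I}
        ((A.card + 1) ^ (s * (A.card / L + 1))) := by
  induction s with
  | zero =>
    intro b hb
    refine ⟨b, le_rfl, fun L A H hBL hLA hHA hH hdeg hcard => ?_⟩
    set T := A.filter fun v => {v} ∈ H with hT
    have hHT : H.card ≤ T.card := by
      refine (Finset.card_le_card (t := T.image fun v => {v}) ?_).trans Finset.card_image_le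
      intro e he
      obtain ⟨h1, h2⟩ := hHA e he
      obtain ⟨v, rfl⟩ := Finset.card_eq_one.1 h2
      exact Finset.mem_image.2 ⟨v, Finset.mem_filter.2 ⟨h1 (by simp), he⟩, rfl⟩
    refine (Coverable.of_forall_subset (C := A \ T) ⟨Finset.sdiff_subset, ?_⟩ ?_).mono subset_rfl
      (by simp)
    swap
    · have := Finset.card_sdiff_add_card_eq_card (Finset.filter_subset (fun v => {v} ∈ H) A)
      rw [← hT] at this
      rw [← this] at hcard ⊢
      simp only [pow_zero, mul_one] at hcard
      nlinarith
    · rintro I ⟨h1, h2⟩ x hx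
      refine Finset.mem_sdiff.2 ⟨h1 hx, fun hxT => ?_⟩
      exact h2 _ (Finset.mem_filter.1 hxT).2 (by simpa using hx)
  | succ s ih =>
    intro b hb
    -- The factor `8 * b * (s + 1)` is the density loss at which the algorithm hands `G` over to the
    -- lower uniformity.
    obtain ⟨B, hbB, hB⟩ := ih (8 * b * (s + 1)) (by positivity)
    have h8 : 8 * b * 2 ≤ 16 * b := by omega
    refine ⟨2 * B, by nlinarith, fun L A H hBL hLA hHA hH hdeg hcard => ?_⟩
    have hB8 : 8 * b ≤ B := by nlinarith
    have hL : 0 < L := by omega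
    have hApos : 0 < A.card := by omega
    have hweak : ∀ C : Finset V, B * C.card + A.card ≤ B * A.card →
        2 * B * C.card + A.card ≤ 2 * B * A.card := by intro C h; nlinarith
    have := coverable_of_isPartialLink (W := (A.card + 1) ^ (s * (A.card / L + 1)))
      (p := fun C => C ⊆ A ∧ 2 * B * C.card + A.card ≤ 2 * B * A.card)
      hHA hH hdeg hcard hL hb (by positivity) ?_ ?_ A.card ∅ ∅ ∅ 0 ?_ (by simp) (by simp)
      (by simp) (by simp)
    · refine this.mono ?_ (le_of_eq ?_)
      · rintro I ⟨h1, h2⟩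
        exact ⟨h1, h2, by simp [Indep], by simp⟩
      · rw [← pow_add]; congr 1; simp; ring
    -- `P` has at least `|A| / B` points and `S` at most `2|A| / L ≤ |A| / (16B)`, so `P \ S` keeps
    -- at least `|A| / (2B)`; this is why `B` doubles.
    · intro P S hP hP8 hS
      refine ⟨Finset.sdiff_subset, ?_⟩
      have h1 : (A \ (P \ S)).card + (P \ S).card = A.card :=
        Finset.card_sdiff_add_card_eq_card (Finset.sdiff_subset.trans hP)
      have h2 := Finset.le_card_sdiff S P
      have h3 : L * (A.card / L) ≤ A.card := Nat.mul_div_le _ _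
      have h4 : 1 ≤ A.card / L := (Nat.one_le_div_iff hL).2 hLA
      have h5 : 32 * B * (A.card / L) ≤ A.card := le_trans (by gcongr; omega) h3
      have h6 : P.card ≤ (P \ S).card + 2 * (A.card / L) := by omega
      have h7 : B * P.card ≤ B * (P \ S).card + B * (2 * (A.card / L)) := by
        rw [← mul_add]; gcongr
      have h9 : A.card ≤ B * P.card := hP8.trans (by gcongr)
      have h10 : 2 * B * (A \ (P \ S)).card + 2 * B * (P \ S).card = 2 * B * A.card := by
        rw [← mul_add, h1]
      nlinarith
    · intro G hG1 hG2 hG3 hG4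
      exact (hB L A G (by omega) hLA hG1 hG2 hG3 hG4).mono_prop
        fun C hC => ⟨hC.1, hweak C hC.2⟩
    · exact ⟨by simp, by simp, by simp [Linear], by simp [deg], by simp⟩

end SetFamily

/-! ### Linear families of arithmetic progressions. -/

/-- The arithmetic progression `a, a + d, …, a + (k - 1) d`. -/
def ap (k a d : ℕ) : Finset ℕ := (Finset.range k).image fun i => a + i * d

theorem ap_subset_iff {k a d : ℕ} {S : Finset ℕ} : ap k a d ⊆ S ↔ ∀ i < k, a + i * d ∈ S := by
  simp [ap, Finset.image_subset_iff]

theorem card_ap {k a d : ℕ} (hd : 0 < d) : (ap k a d).card = k := by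
  rw [ap, Finset.card_image_of_injective, Finset.card_range]
  intro i j hij
  exact Nat.eq_of_mul_eq_mul_right hd (Nat.add_left_cancel hij)

/-- The pairs `(a, d)` with `d > 0` for which `A` contains the `k`-term arithmetic progression with
first term `a` and difference `d`; here `k ≥ 2`. -/
def apPairs (k : ℕ) (A : Finset ℕ) : Finset (ℕ × ℕ) :=
  (A ×ˢ Finset.Icc 1 (A.sup id)).filter fun p => ap k p.1 p.2 ⊆ A

theorem mem_apPairs {k : ℕ} (hk : 2 ≤ k) {A : Finset ℕ} {p : ℕ × ℕ} :
    p ∈ apPairs k A ↔ 0 < p.2 ∧ ap k p.1 p.2 ⊆ A := by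
  rw [apPairs, Finset.mem_filter, Finset.mem_product, Finset.mem_Icc]
  refine ⟨fun h => ⟨h.1.2.1, h.2⟩, fun h => ⟨⟨?_, h.1, ?_⟩, h.2⟩⟩
  · simpa using ap_subset_iff.1 h.2 0 (by omega)
  · have := ap_subset_iff.1 h.2 1 (by omega)
    have := Finset.le_sup (f := id) this
    simp only [id, one_mul] at this
    exact (Nat.le_add_left _ _).trans this

theorem apFree_iff {k : ℕ} {S : Finset ℕ} : APFree k S ↔ ∀ a d, 0 < d → ¬ ap k a d ⊆ S := by
  simp only [APFree, ap_subset_iff]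
  push Not
  rfl

theorem APFree.mono {k : ℕ} {S T : Finset ℕ} (h : APFree k T) (hST : S ⊆ T) : APFree k S := by
  rw [apFree_iff] at h ⊢
  exact fun a d hd hS => h a d hd (hS.trans hST)

theorem mem_apFreeSubsets {k n : ℕ} {S : Finset ℕ} :
    S ∈ apFreeSubsets k n ↔ S ⊆ Finset.Icc 1 n ∧ APFree k S := by
  simp [apFreeSubsets]

open SetFamily

/-- A set meets at most `k ^ 4` progressions of length `k` in two or more points, when it has `k`
elements. -/
theorem card_filter_two_le_inter_ap {k : ℕ} {e : Finset ℕ} (he : e.card = k)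
    (P : Finset (ℕ × ℕ)) (hP : ∀ p ∈ P, 0 < p.2 ∧ 2 ≤ (ap k p.1 p.2 ∩ e).card) :
    P.card ≤ k ^ 4 := by
  -- A progression is recovered from two of its points in `e` and their positions: `k ^ 2` choices
  -- for each pair.
  have hsub : P ⊆ ((e ×ˢ e) ×ˢ Finset.range k ×ˢ Finset.range k).image fun z =>
      (z.1.1 - z.2.1 * ((z.1.2 - z.1.1) / (z.2.2 - z.2.1)),
        (z.1.2 - z.1.1) / (z.2.2 - z.2.1)) := by
    rintro ⟨a, d⟩ hp
    obtain ⟨hd, h2⟩ := hP _ hp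
    obtain ⟨x, hx, y, hy, hxy⟩ := Finset.one_lt_card.1 h2
    wlog hlt : x < y generalizing x y
    · exact this y hy x hx hxy.symm (by omega)
    rw [Finset.mem_inter, ap, Finset.mem_image] at hx hy
    obtain ⟨⟨i, hi, rfl⟩, hxe⟩ := hx
    obtain ⟨⟨j, hj, rfl⟩, hye⟩ := hy
    dsimp only at *
    have hij : i < j := by
      by_contra! h
      have := Nat.mul_le_mul_right d h
      omega
    have hdiv : (a + j * d - (a + i * d)) / (j - i) = d := by
      rw [Nat.add_sub_add_left, ← Nat.sub_mul, Nat.mul_div_cancel_left _ (by omega)]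
    refine Finset.mem_image.2 ⟨((a + i * d, a + j * d), (i, j)), ?_, ?_⟩
    · simp only [Finset.mem_product]
      exact ⟨⟨hxe, hye⟩, hi, hj⟩
    · simp only [hdiv, Nat.add_sub_cancel]
  refine (Finset.card_le_card hsub).trans (Finset.card_image_le.trans (le_of_eq ?_))
  simp only [Finset.card_product, he, Finset.card_range]
  ring

/-- If every large subset of `A` contains many `k`-term progressions, then there is a linear family
of such progressions whose maximum degree is comparable to its average degree. -/
theorem exists_linear_family_ap {k D : ℕ} (hk : 2 ≤ k) {A : Finset ℕ}
    (hA : ∀ A' ⊆ A, A.card ≤ 2 * A'.card → k ^ 4 * (A.card * D) ≤ (apPairs k A').card) :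
    ∃ H : Finset (Finset ℕ), (∀ e ∈ H, e ⊆ A ∧ ∃ a d, 0 < d ∧ e = ap k a d) ∧ Linear H ∧
      (∀ v, deg H v ≤ D) ∧ A.card * D ≤ 2 * k * H.card := by
  classical
  set 𝓗 := A.powerset.powerset.filter fun H : Finset (Finset ℕ) =>
    (∀ e ∈ H, ∃ a d, 0 < d ∧ e = ap k a d) ∧ Linear H ∧ ∀ v, deg H v ≤ D with h𝓗
  obtain ⟨H, hH, hmax⟩ := Finset.exists_max_image 𝓗 Finset.card
    ⟨∅, Finset.mem_filter.2 ⟨by simp, by simp, by simp [Linear], by simp [deg]⟩⟩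
  simp only [h𝓗, Finset.mem_filter, Finset.mem_powerset] at hH hmax
  obtain ⟨hHA, hHap, hlin, hdeg⟩ := hH
  have hHA' : ∀ e ∈ H, e ⊆ A ∧ e.card = k := by
    intro e he
    obtain ⟨a, d, hd, rfl⟩ := hHap e he
    exact ⟨Finset.mem_powerset.1 (hHA he), card_ap hd⟩
  refine ⟨H, fun e he => ⟨(hHA' e he).1, hHap e he⟩, hlin, hdeg, ?_⟩
  set T := A.filter fun v => D ≤ deg H v with hT
  have hTA : (A \ T).card + T.card = A.card :=
    Finset.card_sdiff_add_card_eq_card (Finset.filter_subset _ _)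
  -- Either half of `A` is saturated, and the degree sum is large, or the unsaturated half contains
  -- many progressions.
  by_cases hTc : A.card ≤ 2 * T.card
  · have h1 : T.card * D ≤ k * H.card := by
      rw [← sum_deg_eq hHA', ← smul_eq_mul]
      calc T.card • D ≤ ∑ v ∈ T, deg H v :=
            Finset.card_nsmul_le_sum _ _ _ fun u hu => (Finset.mem_filter.1 hu).2
        _ ≤ _ := Finset.sum_le_sum_of_subset (Finset.filter_subset _ _)
    calc A.card * D ≤ 2 * T.card * D := by gcongr
      _ ≤ 2 * k * H.card := by linarith
  have hmany := hA (A \ T) Finset.sdiff_subset (by omega)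
  have hcover : apPairs k (A \ T) ⊆ H.biUnion fun e =>
      (apPairs k (A \ T)).filter fun p => 2 ≤ (ap k p.1 p.2 ∩ e).card := by
    intro p hp
    obtain ⟨hd, hpA⟩ := (mem_apPairs hk).1 hp
    suffices ∃ e ∈ H, 2 ≤ (ap k p.1 p.2 ∩ e).card by
      obtain ⟨e, he, h2⟩ := this
      exact Finset.mem_biUnion.2 ⟨e, he, Finset.mem_filter.2 ⟨hp, h2⟩⟩
    by_contra! hcon
    have hnot : ap k p.1 p.2 ∉ H := by
      intro h
      have := hcon _ h
      rw [Finset.inter_self, card_ap hd] at this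
      omega
    -- A progression on unsaturated points sharing at most one point with each member of `H` could
    -- be added, against maximality.
    have hle := hmax (insert (ap k p.1 p.2) H) ⟨?_, ?_, ?_, ?_⟩
    · rw [Finset.card_insert_of_notMem hnot] at hle
      omega
    · exact Finset.insert_subset (Finset.mem_powerset.2 (hpA.trans Finset.sdiff_subset)) hHA
    · intro e he
      rcases Finset.mem_insert.1 he with rfl | he
      · exact ⟨_, _, hd, rfl⟩
      · exact hHap e he
    · intro e he f hf h2
      rcases Finset.mem_insert.1 he with rfl | he <;> rcases Finset.mem_insert.1 hf with rfl | hf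
      · rfl
      · exact absurd h2 (not_le.2 (hcon f hf))
      · rw [Finset.inter_comm] at h2
        exact absurd h2 (not_le.2 (hcon e he))
      · exact hlin e he f hf h2
    · intro v
      rw [deg, Finset.filter_insert]
      split_ifs with hv
      · have hv' := Finset.mem_sdiff.1 (hpA hv)
        have : ¬ D ≤ deg H v := fun h => hv'.2 (Finset.mem_filter.2 ⟨hv'.1, h⟩)
        exact (Finset.card_insert_le _ _).trans (not_le.1 this)
      · exact hdeg v
  have hcount : (apPairs k (A \ T)).card ≤ H.card * k ^ 4 := by
    refine (Finset.card_le_card hcover).trans (Finset.card_biUnion_le_card_mul _ _ _ ?_)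
    intro e he
    refine card_filter_two_le_inter_ap (hHA' e he).2 _ fun p hp => ?_
    rw [Finset.mem_filter] at hp
    exact ⟨((mem_apPairs hk).1 hp.1).1, hp.2⟩
  have : A.card * D ≤ H.card := by
    refine Nat.le_of_mul_le_mul_left (c := k ^ 4) ?_ (by positivity)
    linarith
  nlinarith

/-! ### From supersaturation to a bound on the count. -/

/-- Iterating a container theorem that reduces the size of large sets by a constant factor. -/
theorem coverable_of_forall_large {k n s B L a₀ : ℕ} (hB : 0 < B) (hL : 0 < L) (hLa : L ≤ a₀)
    (h : ∀ A ⊆ Finset.Icc 1 n, a₀ ≤ A.card →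
      Coverable (fun C => C ⊆ A ∧ B * C.card + A.card ≤ B * A.card)
        {I | I ⊆ A ∧ APFree k I} ((n + 1) ^ (s * (A.card / L + 1)))) (m : ℕ) :
    ∀ A ⊆ Finset.Icc 1 n, A.card ≤ m → Coverable (fun C => C.card ≤ a₀)
      {I | I ⊆ A ∧ APFree k I} ((n + 1) ^ (2 * s * (B * A.card) / L)) := by
  induction m with
  | zero =>
    intro A hA hm
    exact (Coverable.of_forall_subset (C := A) (by omega) fun I hI => hI.1).mono subset_rfl
      (Nat.one_le_iff_ne_zero.2 (by positivity))
  | succ m ih =>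
    intro A hA hm
    by_cases ha : A.card ≤ a₀
    · exact (Coverable.of_forall_subset (C := A) ha fun I hI => hI.1).mono subset_rfl
        (Nat.one_le_iff_ne_zero.2 (by positivity))
    push Not at ha
    -- The exponents telescope: `B * C.card ≤ B * A.card - A.card` releases `2 * s * A.card / L`,
    -- which pays for this round because `L ≤ A.card`.
    refine ((h A hA ha.le).bind (M₂ := (n + 1) ^ (2 * s * (B * A.card - A.card) / L))
      (q := fun C => C.card ≤ a₀) ?_).mono subset_rfl ?_
    · rintro C ⟨hCA, hC⟩
      have hlt : C.card < A.card := by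
        refine lt_of_mul_lt_mul_left (a := B) ?_ (Nat.zero_le _)
        omega
      refine (ih C (hCA.trans hA) (by omega)).mono ?_ ?_
      · rintro I ⟨⟨-, hI⟩, hIC⟩
        exact ⟨hIC, hI⟩
      · refine Nat.pow_le_pow_right (by omega) (Nat.div_le_div_right ?_)
        gcongr
        omega
    · rw [← pow_add]
      refine Nat.pow_le_pow_right (by omega) ?_
      have h1 : 1 ≤ A.card / L := (Nat.one_le_div_iff hL).2 (by omega)
      have h2 : s * (A.card / L + 1) ≤ 2 * s * A.card / L := by
        refine le_trans ?_ (Nat.mul_div_le_mul_div_assoc _ _ _)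
        nlinarith
      refine (Nat.add_le_add_right h2 _).trans ((Nat.div_add_div_le_add_div).trans ?_)
      refine Nat.div_le_div_right ?_
      have h3 : A.card ≤ B * A.card := Nat.le_mul_of_pos_left _ hB
      rw [← mul_add]
      gcongr
      omega

/-- Supersaturation for sets of size at least `a₀ / 2` bounds the number of `k`-AP-free sets. -/
theorem apFreeCount_le_of_supersaturation {k : ℕ} (hk : 2 ≤ k) :
    ∃ B : ℕ, ∀ n L a₀ : ℕ, 0 < L → B ≤ L → L ≤ a₀ →
      (∀ A ⊆ Finset.Icc 1 n, a₀ ≤ 2 * A.card →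
        k ^ 4 * (2 * A.card * L ^ (k - 1)) ≤ (apPairs k A).card) →
      apFreeCount k n ≤ 2 ^ a₀ * (n + 1) ^ (B * n / L) := by
  obtain ⟨s, rfl⟩ : ∃ s, k = s + 1 := ⟨k - 1, by omega⟩
  obtain ⟨B, hbB, hB⟩ := exists_containers (V := ℕ) s (2 * (s + 1)) (by omega)
  -- The first summand serves the exponent of the iteration, the second the requirement `16 * B ≤
  -- L`.
  refine ⟨2 * s * B + 16 * B, fun n L a₀ hL hBL hLa hsup => ?_⟩
  have hcov := coverable_of_forall_large (k := s + 1) (n := n) (s := s) (B := B) (by omega) hL hLa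
    ?_ n (Finset.Icc 1 n) subset_rfl (by simp)
  · obtain ⟨K, hK1, hK2, hK3⟩ := hcov
    have hsub : apFreeSubsets (s + 1) n ⊆ K.biUnion Finset.powerset := by
      intro I hI
      obtain ⟨C, hC, hIC⟩ := hK3 I (mem_apFreeSubsets.1 hI)
      exact Finset.mem_biUnion.2 ⟨C, hC, Finset.mem_powerset.2 hIC⟩
    calc apFreeCount (s + 1) n ≤ (K.biUnion Finset.powerset).card := Finset.card_le_card hsub
      _ ≤ K.card * 2 ^ a₀ := by
        refine Finset.card_biUnion_le_card_mul _ _ _ fun C hC => ?_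
        rw [Finset.card_powerset]
        exact Nat.pow_le_pow_right (by omega) (hK2 C hC)
      _ ≤ (n + 1) ^ ((2 * s * B + 16 * B) * n / L) * 2 ^ a₀ := by
        gcongr
        refine hK1.trans (Nat.pow_le_pow_right (by omega) (Nat.div_le_div_right ?_))
        rw [Nat.card_Icc, Nat.add_sub_cancel]
        nlinarith
      _ = _ := mul_comm _ _
  · intro A hA ha
    obtain ⟨H, hH1, hH2, hH3, hH4⟩ := exists_linear_family_ap (D := L ^ s) hk (A := A) (by
      intro A' hA' h2
      refine le_trans ?_ (hsup A' (hA'.trans hA) (by omega))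
      gcongr
      simp)
    refine (hB L A H (by omega) (hLa.trans ha) ?_ hH2 hH3 hH4).mono ?_ ?_
    · intro e he
      obtain ⟨h1, a, d, hd, rfl⟩ := hH1 e he
      exact ⟨h1, card_ap hd⟩
    · rintro I ⟨hIA, hI⟩
      refine ⟨hIA, fun e he heI => ?_⟩
      obtain ⟨-, a, d, hd, rfl⟩ := hH1 e he
      exact apFree_iff.1 hI a d hd heI
    · gcongr
      simpa using Finset.card_le_card hA

/-! ### Supersaturation along prime differences. -/

theorem card_le_apFreeMax {k n : ℕ} {S : Finset ℕ} (hS : S ⊆ Finset.Icc 1 n) (h : APFree k S) :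
    S.card ≤ apFreeMax k n :=
  Finset.le_sup (f := Finset.card) (mem_apFreeSubsets.2 ⟨hS, h⟩)

/-- Every element beyond the first `r_k(M)` contributes a progression. -/
theorem card_le_apFreeMax_add_card_apPairs {k M : ℕ} (hk : 2 ≤ k) (J : Finset ℕ)
    (hJ : J ⊆ Finset.Icc 1 M) : J.card ≤ apFreeMax k M + (apPairs k J).card := by
  induction J using Finset.strongInduction with
  | H J ih =>
    by_cases hfree : APFree k J
    · exact (card_le_apFreeMax hJ hfree).trans (Nat.le_add_right _ _)
    rw [apFree_iff] at hfree
    push Not at hfree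
    obtain ⟨a, d, hd, had⟩ := hfree
    have haJ : a ∈ J := by simpa using ap_subset_iff.1 had 0 (by omega)
    have h1 := ih _ (Finset.erase_ssubset haJ) ((Finset.erase_subset _ _).trans hJ)
    have h2 : apPairs k (J.erase a) ⊆ (apPairs k J).erase (a, d) := by
      intro p hp
      rw [mem_apPairs hk] at hp
      refine Finset.mem_erase.2 ⟨?_, (mem_apPairs hk).2 ⟨hp.1, hp.2.trans (Finset.erase_subset _ _)⟩⟩
      rintro rfl
      have := ap_subset_iff.1 hp.2 0 (by omega)
      simp at this
    have h3 := Finset.card_le_card h2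
    have h4 : (a, d) ∈ apPairs k J := (mem_apPairs hk).2 ⟨hd, had⟩
    rw [Finset.card_erase_of_mem h4] at h3
    rw [Finset.card_erase_of_mem haJ] at h1
    have := Finset.card_pos.2 ⟨_, h4⟩
    omega

/-- Limits how often a progression is counted; with all differences in place of primes, the divisor
function would appear instead. -/
theorem card_primeFactors_le_log {y : ℕ} (hy : y ≠ 0) : y.primeFactors.card ≤ Nat.log 2 y := by
  refine Nat.le_log_of_pow_le one_lt_two ?_
  calc 2 ^ y.primeFactors.card ≤ ∏ p ∈ y.primeFactors, p :=
        Finset.pow_card_le_prod _ _ _ fun p hp => (Nat.prime_of_mem_primeFactors hp).two_le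
    _ ≤ y := Nat.le_of_dvd (Nat.pos_of_ne_zero hy) (Nat.prod_primeFactors_dvd y)

/-- The `i ∈ [M]` for which the `i`-th term of the progression with difference `d` that starts at
`a - n` is in `A`. -/
def pullback (n M : ℕ) (A : Finset ℕ) (d a : ℕ) : Finset ℕ :=
  (Finset.Icc 1 M).filter fun i => a + i * d - n ∈ A

theorem mul_card_le_sum_card_pullback {n M d : ℕ} {A : Finset ℕ} (hA : A ⊆ Finset.Icc 1 n)
    (hd : 0 < d) (hdM : d * M ≤ n) :
    M * A.card ≤ ∑ a ∈ Finset.range (2 * n), (pullback n M A d a).card := by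
  rw [← Finset.card_sigma]
  calc M * A.card = (Finset.Icc 1 M ×ˢ A).card := by simp
    _ ≤ _ := by
      have hle : ∀ i ∈ Finset.Icc 1 M, 1 ≤ i * d ∧ i * d ≤ n := by
        intro i hi
        rw [Finset.mem_Icc] at hi
        exact ⟨Nat.mul_pos hi.1 hd, by nlinarith⟩
      -- The start `x - i * d` may be negative; as `i * d ≤ n`, shifting by `n` puts it in `[0,
      -- 2n)`.
      refine Finset.card_le_card_of_injOn (fun z => ⟨z.2 + n - z.1 * d, z.1⟩) ?_ ?_
      · rintro ⟨i, x⟩ hz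
        obtain ⟨hi, hx⟩ := Finset.mem_product.1 hz
        have h1 := hle i hi
        have h2 := Finset.mem_Icc.1 (hA hx)
        dsimp only at *
        refine Finset.mem_sigma.2 ⟨Finset.mem_range.2 ?_, Finset.mem_filter.2 ⟨hi, ?_⟩⟩
        · dsimp only; omega
        · dsimp only
          rwa [show x + n - i * d + i * d - n = x by omega]
      · rintro ⟨i, x⟩ hz ⟨i', x'⟩ hz' h
        obtain ⟨hi, hx⟩ := Finset.mem_product.1 hz
        have h1 := hle i hi
        simp only [Sigma.mk.injEq, heq_eq_eq] at h
        obtain ⟨h3, rfl⟩ := h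
        dsimp only at *
        simp only [Prod.mk.injEq, true_and]
        omega

/-- The progressions inside the pullbacks along prime differences are counted by the progressions
of `A`, with small multiplicity. -/
theorem sum_card_apPairs_pullback_le {k n M X : ℕ} (hk : 2 ≤ k) {A : Finset ℕ}
    (hA : A ⊆ Finset.Icc 1 n) :
    ∑ d ∈ Nat.primesLE X, ∑ a ∈ Finset.range (2 * n), (apPairs k (pullback n M A d a)).card ≤
      (apPairs k A).card * (Nat.log 2 n * M) := by
  simp_rw [← Finset.card_sigma]
  calc _ ≤ ((apPairs k A).sigma fun p => p.2.primeFactors ×ˢ Finset.Icc 1 M).card := ?_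
    _ ≤ _ := ?_
  · have key : ∀ d a i δ, d.Prime → 0 < δ → ap k i δ ⊆ pullback n M A d a →
        n < a + i * d ∧ i ∈ Finset.Icc 1 M ∧ ap k (a + i * d - n) (δ * d) ⊆ A := by
      intro d a i δ hd hδ hsub
      rw [ap_subset_iff] at hsub
      have h0 := Finset.mem_filter.1 (hsub 0 (by omega))
      simp only [zero_mul, add_zero] at h0
      -- Since `0 ∉ A`, the subtraction of `n` is not truncated.
      have h1 := (Finset.mem_Icc.1 (hA h0.2)).1
      refine ⟨by omega, h0.1, ap_subset_iff.2 fun j hj => ?_⟩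
      have := (Finset.mem_filter.1 (hsub j hj)).2
      rwa [add_mul, show a + (i * d + j * δ * d) - n = a + i * d - n + j * (δ * d) by
        rw [mul_assoc]; omega] at this
    refine Finset.card_le_card_of_injOn
      (fun z => ⟨(z.2.1 + z.2.2.1 * z.1 - n, z.2.2.2 * z.1), (z.1, z.2.2.1)⟩) ?_ ?_
    · rintro ⟨d, a, i, δ⟩ hz
      simp only [Finset.coe_sigma, Set.mem_sigma_iff, Finset.mem_coe, Nat.mem_primesLE,
        mem_apPairs hk] at hz
      obtain ⟨⟨-, hd⟩, -, hδ, hsub⟩ := hz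
      obtain ⟨h1, h2, h3⟩ := key d a i δ hd hδ hsub
      simp only [Finset.coe_sigma, Set.mem_sigma_iff, Finset.mem_coe, mem_apPairs hk,
        Finset.mem_product, Nat.mem_primeFactors]
      have := Nat.mul_pos hδ hd.pos
      exact ⟨⟨this, h3⟩, ⟨hd, Dvd.intro_left _ rfl, this.ne'⟩, h2⟩
    -- Given `d` and `i`, the difference determines `δ` and the first term determines `a`.
    · rintro ⟨d, a, i, δ⟩ hz ⟨d', a', i', δ'⟩ hz' h
      simp only [Finset.coe_sigma, Set.mem_sigma_iff, Finset.mem_coe, Nat.mem_primesLE,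
        mem_apPairs hk] at hz hz'
      simp only [Sigma.mk.injEq, Prod.mk.injEq, heq_eq_eq] at h
      obtain ⟨⟨h1, h2⟩, rfl, rfl⟩ := h
      obtain ⟨⟨-, hd⟩, -, hδ, hsub⟩ := hz
      obtain ⟨-, -, hδ', hsub'⟩ := hz'
      have h3 := (key d a i δ hd hδ hsub).1
      have h4 := (key d a' i δ' hd hδ' hsub').1
      obtain rfl := Nat.eq_of_mul_eq_mul_right hd.pos h2
      obtain rfl : a = a' := by omega
      rfl
  · rw [Finset.card_sigma, ← smul_eq_mul (a := (apPairs k A).card)]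
    refine Finset.sum_le_card_nsmul _ _ _ ?_
    rintro ⟨x, y⟩ hp
    obtain ⟨hy, hsub⟩ := (mem_apPairs hk).1 hp
    dsimp only at *
    rw [Finset.card_product, Nat.card_Icc, Nat.add_sub_cancel]
    gcongr
    refine (card_primeFactors_le_log hy.ne').trans (Nat.log_mono_right ?_)
    have := Finset.mem_Icc.1 (hA (ap_subset_iff.1 hsub 1 (by omega)))
    omega

/-- **Supersaturation.** A set whose density in `[n]` is at least four times the maximum density
of a `k`-AP-free subset of `[M]` contains many `k`-term progressions. -/
theorem primeCounting_mul_card_le {k n M X : ℕ} (hk : 2 ≤ k) (hM : 0 < M) (hX : X * M ≤ n)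
    {A : Finset ℕ} (hA : A ⊆ Finset.Icc 1 n)
    (hAM : 4 * (n * apFreeMax k M) ≤ M * A.card) :
    Nat.primeCounting X * A.card ≤ 2 * Nat.log 2 n * (apPairs k A).card := by
  have hd : ∀ d ∈ Nat.primesLE X, M * A.card ≤
      2 * ∑ a ∈ Finset.range (2 * n), (apPairs k (pullback n M A d a)).card := by
    intro d hd
    rw [Nat.mem_primesLE] at hd
    have h1 := mul_card_le_sum_card_pullback hA hd.2.pos
      ((Nat.mul_le_mul_right M hd.1).trans hX)
    have h2 : ∑ a ∈ Finset.range (2 * n), (pullback n M A d a).card ≤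
        ∑ a ∈ Finset.range (2 * n), (apFreeMax k M + (apPairs k (pullback n M A d a)).card) :=
      Finset.sum_le_sum fun a _ =>
        card_le_apFreeMax_add_card_apPairs hk _ (Finset.filter_subset _ _)
    rw [Finset.sum_add_distrib, Finset.sum_const, Finset.card_range, smul_eq_mul] at h2
    linarith
  have hsum := Finset.card_nsmul_le_sum _ _ _ hd
  rw [← Finset.mul_sum, smul_eq_mul, Nat.primesLE_card_eq_primeCounting] at hsum
  have h := sum_card_apPairs_pullback_le (k := k) (M := M) (X := X) hk hA
  refine Nat.le_of_mul_le_mul_left (c := M) ?_ hM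
  linarith

/-! ### Lower bounds and the density along `2 ^ t ^ 2`. -/

theorem two_pow_apFreeMax_le_apFreeCount {k : ℕ} (hk : 0 < k) (n : ℕ) :
    2 ^ apFreeMax k n ≤ apFreeCount k n := by
  have hne : (apFreeSubsets k n).Nonempty :=
    ⟨∅, mem_apFreeSubsets.2 ⟨by simp, fun ⟨a, d, _, h⟩ => by simpa using h 0 hk⟩⟩
  obtain ⟨S, hS, hmax⟩ := Finset.exists_mem_eq_sup _ hne Finset.card
  rw [apFreeMax, hmax, ← Finset.card_powerset]
  refine Finset.card_le_card fun T hT => ?_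
  rw [Finset.mem_powerset] at hT
  rw [mem_apFreeSubsets] at hS ⊢
  exact ⟨hT.trans hS.1, hS.2.mono hT⟩

theorem apFreeMax_le (k n : ℕ) : apFreeMax k n ≤ n := by
  refine Finset.sup_le fun S hS => ?_
  simpa using Finset.card_le_card (mem_apFreeSubsets.1 hS).1

theorem rothNumberNat_le_apFreeMax {k : ℕ} (hk : 3 ≤ k) (n : ℕ) :
    rothNumberNat n ≤ apFreeMax k n := by
  have h := addRothNumber_Ico 1 (n + 1)
  rw [Nat.add_sub_cancel] at h
  obtain ⟨S, hS, hcard, hfree⟩ := addRothNumber_spec (Finset.Ico 1 (n + 1))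
  rw [← h, ← hcard]
  refine card_le_apFreeMax (fun x hx => ?_) (apFree_iff.2 fun a d hd hsub => ?_)
  · have := Finset.mem_Ico.1 (hS hx)
    exact Finset.mem_Icc.2 (by omega)
  · rw [ap_subset_iff] at hsub
    have := hfree (hsub 0 (by omega)) (hsub 1 (by omega)) (hsub 2 (by omega)) (by ring)
    omega

/-- Behrend's lower bound along the sequence `2 ^ t ^ 2`. -/
theorem two_pow_sq_le_mul_apFreeMax {k : ℕ} (hk : 3 ≤ k) (t : ℕ) :
    2 ^ t ^ 2 ≤ 2 ^ (5 * t) * apFreeMax k (2 ^ t ^ 2) := by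
  have h1 := Behrend.roth_lower_bound (N := 2 ^ t ^ 2)
  have h2 : ((rothNumberNat (2 ^ t ^ 2) : ℕ) : ℝ) ≤ apFreeMax k (2 ^ t ^ 2) := by
    exact_mod_cast rothNumberNat_le_apFreeMax hk _
  have hlog : √(Real.log ((2 ^ t ^ 2 : ℕ) : ℝ)) = t * √(Real.log 2) := by
    push_cast
    rw [Real.log_pow]
    push_cast
    rw [Real.sqrt_mul (by positivity), Real.sqrt_sq (by positivity)]
  have hexp : (2 : ℝ) ^ (5 * t) * Real.exp (-4 * √(Real.log ((2 ^ t ^ 2 : ℕ) : ℝ))) ≥ 1 := by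
    rw [hlog, ← Real.exp_log (show (0 : ℝ) < 2 ^ (5 * t) by positivity), ← Real.exp_add,
      Real.log_pow]
    refine Real.one_le_exp ?_
    -- The constant `5` works because `√(log 2) ≥ 4 / 5`.
    have h4 : 4 * √(Real.log 2) ≤ 5 * Real.log 2 := by
      have hl := Real.log_two_gt_d9
      have hs := Real.sq_sqrt (show (0 : ℝ) ≤ Real.log 2 by linarith)
      have hs0 : (0.8 : ℝ) ≤ √(Real.log 2) := Real.le_sqrt_of_sq_le (by norm_num; linarith)
      nlinarith
    have : (t : ℝ) * (4 * √(Real.log 2)) ≤ t * (5 * Real.log 2) := by gcongr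
    push_cast
    linarith
  have : ((2 ^ t ^ 2 : ℕ) : ℝ) ≤ 2 ^ (5 * t) * apFreeMax k (2 ^ t ^ 2) := by
    have hpos : (0 : ℝ) < ((2 ^ t ^ 2 : ℕ) : ℝ) := by positivity
    calc ((2 ^ t ^ 2 : ℕ) : ℝ) ≤ ((2 ^ t ^ 2 : ℕ) : ℝ) *
          ((2 : ℝ) ^ (5 * t) * Real.exp (-4 * √(Real.log ((2 ^ t ^ 2 : ℕ) : ℝ)))) :=
          le_mul_of_one_le_right hpos.le hexp
      _ = (2 : ℝ) ^ (5 * t) * (((2 ^ t ^ 2 : ℕ) : ℝ) *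
          Real.exp (-4 * √(Real.log ((2 ^ t ^ 2 : ℕ) : ℝ)))) := by ring
      _ ≤ _ := by gcongr; exact h1.trans h2
  exact_mod_cast this

/-- Along the sequence `2 ^ t ^ 2`, the density of the largest `k`-AP-free sets infinitely often
drops by at most a constant factor when `t - c` is replaced by `t`. -/
theorem exists_density_le_mul_density {k : ℕ} (hk : 3 ≤ k) (c T : ℕ) : ∃ t, T ≤ t ∧ c ≤ t ∧
    2 ^ t ^ 2 * apFreeMax k (2 ^ (t - c) ^ 2) ≤
      2 ^ (5 * c + 1) * (2 ^ (t - c) ^ 2 * apFreeMax k (2 ^ t ^ 2)) := by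
  by_contra! hcon
  set f : ℕ → ℝ := fun t => (apFreeMax k (2 ^ t ^ 2) : ℝ) / 2 ^ t ^ 2 with hf
  have hstep : ∀ t, T ≤ t → 2 ^ (5 * c + 1) * f (t + c) ≤ f t := by
    intro t ht
    have h := hcon (t + c) (by omega) (by omega)
    rw [Nat.add_sub_cancel] at h
    have h' : (2 : ℝ) ^ (5 * c + 1) * (2 ^ t ^ 2 * apFreeMax k (2 ^ (t + c) ^ 2)) ≤
        2 ^ (t + c) ^ 2 * apFreeMax k (2 ^ t ^ 2) := by exact_mod_cast h.le
    simp only [hf]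
    rw [← mul_div_assoc, div_le_div_iff₀ (by positivity) (by positivity)]
    linarith
  have hiter : ∀ s, (2 ^ (5 * c + 1)) ^ s * f (T + c * s) ≤ f T := by
    intro s
    induction s with
    | zero => simp
    | succ s ih =>
      refine le_trans ?_ ih
      rw [pow_succ, mul_assoc]
      gcongr
      rw [mul_add_one, ← add_assoc]
      exact hstep (T + c * s) (by omega)
  have hf1 : f T ≤ 1 := by
    simp only [hf]
    rw [div_le_one (by positivity)]
    exact_mod_cast apFreeMax_le k (2 ^ T ^ 2)
  have hlow : ∀ t, 1 ≤ 2 ^ (5 * t) * f t := by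
    intro t
    simp only [hf]
    rw [← mul_div_assoc, le_div_iff₀ (by positivity), one_mul]
    exact_mod_cast two_pow_sq_le_mul_apFreeMax hk t
  -- Chosen so that the assumed decay `(5c + 1)s` exceeds Behrend's allowance `5(T + cs)`.
  set s := 5 * T + 1 with hs
  have h1 := (hiter s).trans hf1
  have h2 := hlow (T + c * s)
  have hfpos : 0 < f (T + c * s) := by
    by_contra! hle
    have : (2 : ℝ) ^ (5 * (T + c * s)) * f (T + c * s) ≤ 0 :=
      mul_nonpos_of_nonneg_of_nonpos (by positivity) hle
    linarith
  have h3 : (2 : ℝ) ^ (5 * (T + c * s)) < (2 ^ (5 * c + 1)) ^ s := by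
    rw [← pow_mul]
    refine pow_lt_pow_right₀ one_lt_two ?_
    rw [hs]
    nlinarith
  have h4 := mul_lt_mul_of_pos_right h3 hfpos
  linarith

/-! ### Prime counts and the choice of parameters. -/

/-- Chebyshev's bound at `2 ^ x`; the `+ 2` absorbs the error `log (2 ^ x + 1) ≤ 2 * x * log 2`. -/
theorem two_pow_le_mul_primeCounting {x : ℕ} (hx : 0 < x) :
    2 ^ x ≤ x * (Nat.primeCounting (2 ^ x) + 2) := by
  have h := Chebyshev.pi_ge (2 ^ x)
  have hl2 : 0 < Real.log 2 := Real.log_pos one_lt_two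
  have hx' : (1 : ℝ) ≤ x := by exact_mod_cast hx
  push_cast at h
  rw [Real.log_pow, div_le_iff₀ (by positivity)] at h
  have h1 : Real.log ((2 : ℝ) ^ x + 1) ≤ (x + 1) * Real.log 2 := by
    rw [show ((x : ℝ) + 1) = ((x + 1 : ℕ) : ℝ) by push_cast; rfl, ← Real.log_pow]
    refine Real.log_le_log (by positivity) ?_
    rw [pow_succ]
    have : (1 : ℝ) ≤ 2 ^ x := one_le_pow₀ one_le_two
    linarith
  have h2 : (2 : ℝ) ^ x * Real.log 2 ≤
      (Nat.primeCounting (2 ^ x) * x + (x + 1)) * Real.log 2 := by linarith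
  have h3 := le_of_mul_le_mul_right h2 hl2
  have h4 : (2 : ℝ) ^ x ≤ x * (Nat.primeCounting (2 ^ x) + 2) := by linarith
  exact_mod_cast h4

theorem exists_forall_mul_pow_le_two_pow (K m : ℕ) : ∃ T, ∀ t, T ≤ t → K * t ^ m ≤ 2 ^ t := by
  have h := (tendsto_pow_const_div_const_pow_of_one_lt m (one_lt_two (α := ℝ))).const_mul (K : ℝ)
  rw [mul_zero] at h
  obtain ⟨T, hT⟩ := Filter.eventually_atTop.1 (h.eventually (gt_mem_nhds one_pos))
  refine ⟨T, fun t ht => ?_⟩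
  have := hT t ht
  rw [← mul_div_assoc, div_lt_one (by positivity)] at this
  exact_mod_cast this.le

/-- There are enough primes up to `2 ^ (2 c t - c ^ 2)`, with `c = 3 k`, for supersaturation. -/
theorem mul_pow_le_primeCounting {k t : ℕ} (hk : 1 ≤ k) (ht : 3 * k ≤ t)
    (hlarge : 2 ^ (9 * k ^ 2) * (36 * k ^ 5) * t ^ 3 ≤ 2 ^ t) :
    k ^ 4 * 4 * t ^ 2 * (2 ^ (6 * t)) ^ (k - 1) ≤
      Nat.primeCounting (2 ^ (6 * k * t - 9 * k ^ 2)) := by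
  obtain ⟨s, rfl⟩ : ∃ s, k = s + 1 := ⟨k - 1, by omega⟩
  set k := s + 1 with hks
  rw [hks, Nat.add_sub_cancel, ← hks]
  have hkt : 9 * k ^ 2 < 6 * k * t := by nlinarith
  set x := 6 * k * t - 9 * k ^ 2 with hx
  have hprime := two_pow_le_mul_primeCounting (x := x) (by omega)
  by_contra! hlt
  set Q := (2 ^ (6 * t)) ^ s with hQ
  have hQ1 : 1 ≤ Q := Nat.one_le_iff_ne_zero.2 (by positivity)
  -- The power `2 ^ (6kt)` exceeds `Q` by the factor `2 ^ (6t)`, while the polynomial and constant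
  -- losses are only `2 ^ t`.
  have hpow : 2 ^ (9 * k ^ 2) * 2 ^ x = 2 ^ (6 * t) * Q := by
    rw [hQ, ← pow_mul, ← pow_add, ← pow_add]
    congr 1
    rw [hx, Nat.add_sub_cancel' hkt.le, hks]
    ring
  have ht1 : 1 ≤ t := by omega
  have h1 : 2 ^ x < 36 * k ^ 5 * t ^ 3 * Q := by
    have hb : Nat.primeCounting (2 ^ x) + 2 < 6 * k ^ 4 * t ^ 2 * Q := by
      have : 1 * 1 * 1 ≤ k ^ 4 * t ^ 2 * Q := by gcongr <;> exact Nat.one_le_pow _ _ (by omega)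
      nlinarith
    calc 2 ^ x ≤ x * (Nat.primeCounting (2 ^ x) + 2) := hprime
      _ ≤ 6 * k * t * (Nat.primeCounting (2 ^ x) + 2) := by gcongr; omega
      _ < 6 * k * t * (6 * k ^ 4 * t ^ 2 * Q) := by gcongr
      _ = _ := by ring
  have h2 : 2 ^ (6 * t) * Q < 2 ^ t * Q := by
    rw [← hpow]
    calc 2 ^ (9 * k ^ 2) * 2 ^ x < 2 ^ (9 * k ^ 2) * (36 * k ^ 5 * t ^ 3 * Q) := by gcongr
      _ = 2 ^ (9 * k ^ 2) * (36 * k ^ 5) * t ^ 3 * Q := by ring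
      _ ≤ _ := by gcongr
  have h3 : 2 ^ t * Q ≤ 2 ^ (6 * t) * Q := by gcongr <;> omega
  omega

/-- If passing from `2 ^ (t - 3 k) ^ 2` to `2 ^ t ^ 2` does not decrease the maximum density of
`k`-AP-free sets too much, then there are few `k`-AP-free subsets of `[2 ^ t ^ 2]`. -/
theorem apFreeCount_two_pow_sq_le {k B t : ℕ} (hk : 3 ≤ k)
    (hB : ∀ n L a₀ : ℕ, 0 < L → B ≤ L → L ≤ a₀ →
      (∀ A ⊆ Finset.Icc 1 n, a₀ ≤ 2 * A.card →
        k ^ 4 * (2 * A.card * L ^ (k - 1)) ≤ (apPairs k A).card) →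
      apFreeCount k n ≤ 2 ^ a₀ * (n + 1) ^ (B * n / L))
    (hkt : 3 * k ≤ t) (ht : 11 ≤ t)
    (hprimes : 2 ^ (9 * k ^ 2) * (36 * k ^ 5) * t ^ 3 ≤ 2 ^ t) (hBt : 2 * B * t ^ 2 ≤ 2 ^ t)
    (hdens : 2 ^ t ^ 2 * apFreeMax k (2 ^ (t - 3 * k) ^ 2) ≤
      2 ^ (5 * (3 * k) + 1) * (2 ^ (t - 3 * k) ^ 2 * apFreeMax k (2 ^ t ^ 2))) :
    apFreeCount k (2 ^ t ^ 2) ≤ 2 ^ ((2 ^ (15 * k + 4) + 1) * apFreeMax k (2 ^ t ^ 2)) := by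
  set n := 2 ^ t ^ 2 with hn
  set M := 2 ^ (t - 3 * k) ^ 2 with hM
  set r := apFreeMax k n with hr
  have hbeh : n ≤ 2 ^ (5 * t) * r := two_pow_sq_le_mul_apFreeMax hk t
  have ht1 : 1 ≤ t ^ 2 := Nat.one_le_pow _ _ (by omega)
  have hLr : 2 ^ (6 * t) ≤ r := by
    refine Nat.le_of_mul_le_mul_left (le_trans ?_ hbeh) (show 0 < 2 ^ (5 * t) by positivity)
    rw [← pow_add, hn]
    exact Nat.pow_le_pow_right (by omega) (by nlinarith)
  have hXM : 2 ^ (6 * k * t - 9 * k ^ 2) * M = n := by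
    rw [hn, hM, ← pow_add]
    congr 1
    obtain ⟨u, rfl⟩ : ∃ u, t = u + 3 * k := ⟨t - 3 * k, by omega⟩
    rw [Nat.add_sub_cancel, show 6 * k * (u + 3 * k) = 6 * k * u + 9 * k ^ 2 + 9 * k ^ 2 by ring,
      Nat.add_sub_cancel]
    ring
  -- With `L = 2 ^ (6t)`, Behrend's bound gives `n / L ≤ r / 2 ^ t`, so the container count costs at
  -- most `2 ^ r`. In `2 ^ (15k + 4)`, `15k + 1` comes from the density comparison, two more from
  -- the factor `4` in supersaturation and one from halving.
  have hcount := hB n (2 ^ (6 * t)) (2 ^ (15 * k + 4) * r) (by positivity) ?_ ?_ ?_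
  · refine hcount.trans ?_
    rw [add_mul, one_mul, pow_add 2 (2 ^ (15 * k + 4) * r) r]
    refine Nat.mul_le_mul_left _ ?_
    set E := B * n / 2 ^ (6 * t) with hE
    have hE1 : E * 2 ^ (6 * t) ≤ B * n := Nat.div_mul_le_self _ _
    have hE2 : E * 2 ^ t ≤ B * r := by
      refine Nat.le_of_mul_le_mul_left (c := 2 ^ (5 * t)) ?_ (by positivity)
      calc 2 ^ (5 * t) * (E * 2 ^ t) = E * 2 ^ (6 * t) := by
            rw [show 6 * t = 5 * t + t by ring, pow_add]; ring
        _ ≤ B * n := hE1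
        _ ≤ B * (2 ^ (5 * t) * r) := by gcongr
        _ = _ := by ring
    have hE3 : (t ^ 2 + 1) * E ≤ r := by
      refine Nat.le_of_mul_le_mul_left (c := 2 ^ t) ?_ (by positivity)
      calc 2 ^ t * ((t ^ 2 + 1) * E) = (t ^ 2 + 1) * (E * 2 ^ t) := by ring
        _ ≤ (2 * t ^ 2) * (B * r) := by gcongr; omega
        _ = 2 * B * t ^ 2 * r := by ring
        _ ≤ _ := by gcongr
    calc (n + 1) ^ E ≤ (2 ^ (t ^ 2 + 1)) ^ E := by
          gcongr
          rw [pow_succ, ← hn]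
          have : 0 < n := by positivity
          omega
      _ = 2 ^ ((t ^ 2 + 1) * E) := (pow_mul _ _ _).symm
      _ ≤ 2 ^ r := Nat.pow_le_pow_right (by omega) hE3
  · calc B ≤ 2 * B * t ^ 2 := by nlinarith
      _ ≤ 2 ^ t := hBt
      _ ≤ 2 ^ (6 * t) := Nat.pow_le_pow_right (by omega) (by omega)
  · exact hLr.trans (Nat.le_mul_of_pos_left _ (by positivity))
  · intro A hA ha
    have hdense : 4 * (n * apFreeMax k M) ≤ M * A.card := by
      have h1 : 2 ^ (5 * (3 * k) + 1) * r * 4 ≤ A.card := by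
        rw [show 15 * k + 4 = 5 * (3 * k) + 1 + 3 by ring, pow_add _ _ 3] at ha
        linarith
      calc 4 * (n * apFreeMax k M) ≤ 4 * (2 ^ (5 * (3 * k) + 1) * (M * r)) := by gcongr
        _ = M * (2 ^ (5 * (3 * k) + 1) * r * 4) := by ring
        _ ≤ _ := by gcongr
    have hsup := primeCounting_mul_card_le (k := k) (by omega) (by positivity) hXM.le hA hdense
    have hpr := mul_pow_le_primeCounting (k := k) (by omega) hkt hprimes
    rw [hn, Nat.log_pow one_lt_two] at hsup
    refine Nat.le_of_mul_le_mul_left (c := 2 * t ^ 2) (le_trans ?_ hsup) (by positivity)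
    calc 2 * t ^ 2 * (k ^ 4 * (2 * A.card * (2 ^ (6 * t)) ^ (k - 1)))
        = k ^ 4 * 4 * t ^ 2 * (2 ^ (6 * t)) ^ (k - 1) * A.card := by ring
      _ ≤ _ := by gcongr

/-- For every `k ≥ 3` there is a constant `C = C(k) > 0` with `R_k(n) ≤ 2 ^ (C * r_k(n))` for
infinitely many `n`; the exponent is optimal up to the constant, as `2 ^ r_k(n) ≤ R_k(n)` for
all `n`. -/
theorem theorem1p2 (k : ℕ) (hk : 3 ≤ k) :
    (∃ C : ℝ, 0 < C ∧
      {n : ℕ | (apFreeCount k n : ℝ) ≤ (2 : ℝ) ^ (C * (apFreeMax k n : ℝ))}.Infinite) ∧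
    ∀ n : ℕ, 2 ^ apFreeMax k n ≤ apFreeCount k n := by
  refine ⟨⟨((2 ^ (15 * k + 4) + 1 : ℕ) : ℝ), by positivity, ?_⟩,
    two_pow_apFreeMax_le_apFreeCount (by omega)⟩
  obtain ⟨B, hB⟩ := apFreeCount_le_of_supersaturation (k := k) (by omega)
  obtain ⟨T₁, hT₁⟩ := exists_forall_mul_pow_le_two_pow (2 ^ (9 * k ^ 2) * (36 * k ^ 5)) 3
  obtain ⟨T₂, hT₂⟩ := exists_forall_mul_pow_le_two_pow (2 * B) 2
  refine Set.infinite_of_forall_exists_gt fun N => ?_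
  obtain ⟨t, hT, hkt, hdens⟩ := exists_density_le_mul_density hk (3 * k) (N + T₁ + T₂ + 11)
  refine ⟨2 ^ t ^ 2, ?_, ?_⟩
  · have := apFreeCount_two_pow_sq_le hk hB hkt (by omega) (hT₁ t (by omega)) (hT₂ t (by omega))
      hdens
    rw [Set.mem_ofPred_eq, ← Nat.cast_mul, Real.rpow_natCast]
    exact_mod_cast this
  · calc N < t := by omega
      _ ≤ t ^ 2 := Nat.le_self_pow two_ne_zero t
      _ < 2 ^ t ^ 2 := Nat.lt_two_pow_self
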